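/- Let $(A,[\cdot,\cdot],\rho)$ be a Lie algebroid over a smooth manifold $M$, let $d$ be its differential on $\Gamma(\bigwedge^\bullet A^*)$, let $\pi\in\Gamma(\bigwedge^2A)$ be a Poisson bivector, i.e. $[\pi,\pi]_{SN}=0$ for the Schouten–Nijenhuis bracket, and let $\omega\in\Gamma(\bigwedge^2A^*)$ be an arbitrary $2$-form. Put $\pi^\sharp(\alpha)=\pi(\alpha,\cdot)$, $\omega^\flat(X)=\omega(X,\cdot)$, $N=\pi^\sharp\circ\omega^\flat$ and $\omega_N=\omega(N\cdot,\cdot)$. For a $3$-form $H$, let $[\cdot,\cdot]$ denote the Dorfman bracket on $\Gamma(A\oplus A^*)$ of the structure $\mu+H$, where $\mu$ is the Lie algebroid structure of $A$; explicitly $$[X+\alpha,Y+\beta]=[X,Y]+\mathcal L_X\beta-i_Yd\alpha-H(X,Y,\cdot),$$ and let $\langle X+\alpha,Y+\beta\rangle=\beta(X)+\alpha(Y)$. When $dH=0$, so that $\mu+H$ is a Courant algebroid structure, a $C^\infty(M)$-linear endomorphism $J$ of $\Gamma(A\oplus A^*)$ is called a subtangent structure on $(A\oplus A^*,\mu+H)$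 (a c.p.s. structure with $\lambda=0$) if it is orthogonal, $\langle J\mathcal X,\mathcal Y\rangle+\langle\mathcal X,J\mathcal Y\rangle=0$, satisfies $J^2=0$, and has vanishing Nijenhuis torsion, $$T_J(\mathcal X,\mathcal Y)=[J\mathcal X,J\mathcal Y]-J\bigl([J\mathcal X,\mathcal Y]+[\mathcal X,J\mathcal Y]-J[\mathcal X,\mathcal Y]\bigr)=0 .$$ **Proposition.** The $3$-form $H=-d\omega$ is closed, and $$J=\begin{pmatrix}N&\pi^\sharp\\-\omega_N^\flat&-{}^tN\end{pmatrix},\qquad J(X+\alpha)=\bigl(NX+\pi^\sharp\alpha\bigr)+\bigl(-\omega_N^\flat X-{}^tN\alpha\bigr),$$ is a subtangent structure on $(A\oplus A^*,\mu-d\omega)$. -/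

import Mathlib

open scoped Manifold ContDiff

noncomputable section

/-! ## Lie algebroids over a smooth manifold -/

section Geometric

variable (E : Type*) [NormedAddCommGroup E] [NormedSpace ℝ E]
  {M : Type*} [TopologicalSpace M] [ChartedSpace E M] [IsManifold 𝓘(ℝ, E) ∞ M]
  (F : Type*) [NormedAddCommGroup F] [NormedSpace ℝ F]
  (V : M → Type*) [TopologicalSpace (Bundle.TotalSpace F V)]
  [∀ x, TopologicalSpace (V x)] [∀ x, AddCommGroup (V x)] [∀ x, Module ℝ (V x)]
  [FiberBundle F V] [VectorBundle ℝ F V]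

/-- A vector bundle `V → M` with an anchor, that is, a smooth morphism of vector bundles
`ρ : V → TM` over the identity of `M`. -/
structure AnchoredBundle where
  anchor : ∀ x : M, V x →ₗ[ℝ] TangentSpace 𝓘(ℝ, E) x
  contMDiff_anchor :
    ContMDiff (𝓘(ℝ, E).prod 𝓘(ℝ, F)) 𝓘(ℝ, E).tangent ∞
      (fun p : Bundle.TotalSpace F V =>
        (⟨p.proj, anchor p.proj p.snd⟩ : TangentBundle 𝓘(ℝ, E) M))

variable {E F V}

/-- The action `ρ(X) f` of a smooth section `X` on a smooth function `f`: the derivative of `f`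
along the vector field `ρ(X)`. -/
def AnchoredBundle.act (A : AnchoredBundle E F V) (X : Cₛ^∞⟮𝓘(ℝ, E); F, V⟯)
    (f : C^∞⟮𝓘(ℝ, E), M; ℝ⟯) : C^∞⟮𝓘(ℝ, E), M; ℝ⟯ where
  val := fun x => mvfderiv 𝓘(ℝ, E) f x (A.anchor x (X x))
  property := by
    have h1 : ContMDiff 𝓘(ℝ, E) 𝓘(ℝ, E).tangent ∞
        (fun x => (⟨x, A.anchor x (X x)⟩ : TangentBundle 𝓘(ℝ, E) M)) :=
      A.contMDiff_anchor.comp X.contMDiff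
    have h2 := (f.contMDiff.contMDiff_tangentMap (m := ∞) le_rfl).comp h1
    exact (contMDiff_snd_tangentBundle_modelSpace ℝ 𝓘(ℝ, ℝ)).comp h2

/-- Multiplication of a smooth section by a smooth function. -/
def sectionSMul (f : C^∞⟮𝓘(ℝ, E), M; ℝ⟯) (X : Cₛ^∞⟮𝓘(ℝ, E); F, V⟯) :
    Cₛ^∞⟮𝓘(ℝ, E); F, V⟯ :=
  ⟨fun x => f x • X x, f.contMDiff.smul_section X.contMDiff⟩

variable (E F V)

/-- A Lie algebroid structure on the smooth vector bundle `V → M` with typical fibre `F`: an anchor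
`ρ : V → TM` and a Lie bracket on the smooth sections of `V`, such that
`[X, f Y] = f [X, Y] + (ρ(X) f) Y` and `ρ [X, Y] = [ρ X, ρ Y]`. -/
structure LieAlgebroid extends AnchoredBundle E F V where
  bracket : Cₛ^∞⟮𝓘(ℝ, E); F, V⟯ →ₗ[ℝ] Cₛ^∞⟮𝓘(ℝ, E); F, V⟯ →ₗ[ℝ] Cₛ^∞⟮𝓘(ℝ, E); F, V⟯
  bracket_self : ∀ X, bracket X X = 0
  jacobi : ∀ X Y Z,
    bracket X (bracket Y Z) = bracket (bracket X Y) Z + bracket Y (bracket X Z)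
  leibniz : ∀ (X Y : Cₛ^∞⟮𝓘(ℝ, E); F, V⟯) (f : C^∞⟮𝓘(ℝ, E), M; ℝ⟯),
    bracket X (sectionSMul f Y) =
      sectionSMul f (bracket X Y) + sectionSMul (toAnchoredBundle.act X f) Y
  anchor_bracket : ∀ (X Y : Cₛ^∞⟮𝓘(ℝ, E); F, V⟯) (f : C^∞⟮𝓘(ℝ, E), M; ℝ⟯),
    toAnchoredBundle.act (bracket X Y) f =
      toAnchoredBundle.act X (toAnchoredBundle.act Y f) -
        toAnchoredBundle.act Y (toAnchoredBundle.act X f)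

variable {E F V}

namespace LieAlgebroid

/-- The space `Γ(A)` of smooth sections of a Lie algebroid, with its structure of Lie–Rinehart
algebra over `C^∞(M)`: `⁅X, Y⁆` is the bracket of sections and `⁅X, f⁆ = ρ(X) f`. -/
def Sec (_A : LieAlgebroid E F V) : Type _ := Cₛ^∞⟮𝓘(ℝ, E); F, V⟯

variable (A : LieAlgebroid E F V)

instance : AddCommGroup A.Sec := inferInstanceAs (AddCommGroup Cₛ^∞⟮𝓘(ℝ, E); F, V⟯)

instance : LieRing A.Sec where
  bracket X Y := A.bracket X Y
  add_lie X Y Z := LinearMap.map_add₂ A.bracket X Y Z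
  lie_add X Y Z := map_add (A.bracket X) Y Z
  lie_self X := A.bracket_self X
  leibniz_lie X Y Z := A.jacobi X Y Z

instance : Module C^∞⟮𝓘(ℝ, E), M; ℝ⟯ A.Sec where
  smul f X := sectionSMul f X
  one_smul X := ContMDiffSection.ext fun x => one_smul ℝ (X.toFun x)
  mul_smul f g X := ContMDiffSection.ext fun x => mul_smul (f x) (g x) (X.toFun x)
  smul_zero f := ContMDiffSection.ext fun x => smul_zero (f x)
  smul_add f X Y := ContMDiffSection.ext fun x => smul_add (f x) (X.toFun x) (Y.toFun x)
  add_smul f g X := ContMDiffSection.ext fun x => add_smul (f x) (g x) (X.toFun x)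
  zero_smul X := ContMDiffSection.ext fun x => zero_smul ℝ (X.toFun x)

instance : LieRingModule A.Sec C^∞⟮𝓘(ℝ, E), M; ℝ⟯ where
  bracket X f := A.act X f
  add_lie X Y f := by
    ext x
    change mvfderiv 𝓘(ℝ, E) f x (A.anchor x (X.toFun x + Y.toFun x)) =
      mvfderiv 𝓘(ℝ, E) f x (A.anchor x (X.toFun x)) +
      mvfderiv 𝓘(ℝ, E) f x (A.anchor x (Y.toFun x))
    rw [map_add, map_add]
  lie_add X f g := by
    ext x
    change mvfderiv 𝓘(ℝ, E) (⇑f + ⇑g) x (A.anchor x (X.toFun x)) =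
      mvfderiv 𝓘(ℝ, E) f x (A.anchor x (X.toFun x)) +
      mvfderiv 𝓘(ℝ, E) g x (A.anchor x (X.toFun x))
    rw [mvfderiv_add f.mdifferentiableAt g.mdifferentiableAt]; rfl
  leibniz_lie X Y f := by
    have h := A.anchor_bracket X Y f
    change A.act X (A.act Y f) = A.act (A.bracket X Y) f + A.act Y (A.act X f)
    rw [h]; abel

instance : LieRinehartRing C^∞⟮𝓘(ℝ, E), M; ℝ⟯ A.Sec where
  lie_smul_eq_mul' f g X := by
    ext x
    change mvfderiv 𝓘(ℝ, E) g x (A.anchor x (f x • X.toFun x)) =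
      f x * mvfderiv 𝓘(ℝ, E) g x (A.anchor x (X.toFun x))
    rw [map_smul, map_smul]; rfl
  leibniz_mul_right' X f g := by
    ext x
    change mvfderiv 𝓘(ℝ, E) (⇑f * ⇑g) x (A.anchor x (X.toFun x)) =
      f x * mvfderiv 𝓘(ℝ, E) g x (A.anchor x (X.toFun x)) +
      mvfderiv 𝓘(ℝ, E) f x (A.anchor x (X.toFun x)) * g x
    rw [mvfderiv_mul f.mdifferentiableAt g.mdifferentiableAt]
    simp [mul_comm]
  leibniz_smul_right' X Y f := A.leibniz X Y f

end LieAlgebroid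

end Geometric

/-! ## Cartan calculus and generalized geometry

`R` stands for `C^∞(M)` and `L` for `Γ(A)`. Then `Γ(A*) = Module.Dual R L` (a `C^∞(M)`-linear form
on sections is the same as a smooth section of the dual bundle), and tensor fields are
`C^∞(M)`-multilinear maps. -/

namespace LieRinehart

open Module (Dual)

section Forms

variable (R L : Type*) [CommRing R] [AddCommGroup L] [Module R L]

/-- A `2`-form `Ω`, an alternating bilinear map on sections; `Ω.flat X = Ω(X, ·)`. -/
structure TwoForm where
  flat : L →ₗ[R] Dual R L
  alt : ∀ X, flat X X = 0

/-- A `3`-form, an alternating trilinear map on sections. -/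
structure ThreeForm where
  toMap : L →ₗ[R] L →ₗ[R] L →ₗ[R] R
  alt₁₂ : ∀ X Y, toMap X X Y = 0
  alt₂₃ : ∀ X Y, toMap X Y Y = 0

/-- A bivector `π`, given by the associated skew-symmetric map `π♯ : Γ(A*) → Γ(A)`,
`π♯ α = π(α, ·)`; thus `π(α, β) = β (π♯ α)`. -/
structure Bivector where
  sharp : Dual R L →ₗ[R] L
  alt : ∀ α : Dual R L, α (sharp α) = 0

variable {R L}

instance : Neg (TwoForm R L) := ⟨fun Ω => ⟨-Ω.flat, fun X => by simp [Ω.alt X]⟩⟩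

set_option maxSynthPendingDepth 3 in
instance : Neg (ThreeForm R L) :=
  ⟨fun H => ⟨-H.toMap, fun X Y => by simp [H.alt₁₂ X Y], fun X Y => by simp [H.alt₂₃ X Y]⟩⟩

theorem TwoForm.swap (Ω : TwoForm R L) (X Y : L) : Ω.flat X Y = -Ω.flat Y X := by
  have h := Ω.alt (X + Y)
  simp only [map_add, LinearMap.add_apply, Ω.alt, zero_add, add_zero] at h
  exact eq_neg_of_add_eq_zero_right h

/-- The `(1,1)`-tensor `N = π♯ ∘ Ω♭`. -/
def nTensor (P : Bivector R L) (Ω : TwoForm R L) : L →ₗ[R] L := P.sharp ∘ₗ Ω.flat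

/-- The `2`-form `Ω_N = Ω(N ·, ·)`, where `N = π♯ ∘ Ω♭`. -/
def omegaN (P : Bivector R L) (Ω : TwoForm R L) : TwoForm R L where
  flat := Ω.flat ∘ₗ nTensor P Ω
  alt X := by
    change Ω.flat (P.sharp (Ω.flat X)) X = 0
    rw [Ω.swap, P.alt, neg_zero]

/-- The endomorphism of `Γ(A ⊕ A*)` with block matrix `[[N, π♯], [σ♭, -ᵗN]]`. -/
def blockJ (N : L →ₗ[R] L) (P : Bivector R L) (σ : TwoForm R L) :
    (L × Dual R L) →ₗ[R] (L × Dual R L) where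
  toFun u := (N u.1 + P.sharp u.2, σ.flat u.1 - N.dualMap u.2)
  map_add' u v := by
    ext <;> simp <;> abel
  map_smul' f u := by
    ext <;> simp [mul_sub]

/-- The pairing `⟨X + α, Y + β⟩ = β(X) + α(Y)`. -/
def pairing (u v : L × Dual R L) : R := v.2 u.1 + u.2 v.1

/-- `J` is an almost c.p.s. structure: it is orthogonal and `J² = lam · id`, with
`lam ∈ {-1, 0, 1}`. -/
structure IsAlmostCPS (lam : ℤ) (J : (L × Dual R L) →ₗ[R] (L × Dual R L)) : Prop where
  lam_mem : lam = -1 ∨ lam = 0 ∨ lam = 1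
  orthogonal : ∀ u v, pairing (J u) v + pairing u (J v) = 0
  sq : ∀ u, J (J u) = lam • u

end Forms

variable {R L : Type*} [CommRing R] [LieRing L] [Module R L] [LieRingModule L R]
  [LieRinehartRing R L]

/-- The Lie derivative of a `1`-form, `(ℒ_X β)(Y) = ρ(X)(β(Y)) - β([X, Y])`. -/
def lieDer (X : L) (β : Dual R L) : Dual R L where
  toFun Y := ⁅X, β Y⁆ - β ⁅X, Y⁆
  map_add' Y Z := by simp only [map_add, lie_add]; abel
  map_smul' f Y := by
    simp only [map_smul, map_add, smul_eq_mul, LieRinehartRing.leibniz_mul_right,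
      LieRinehartRing.leibniz_smul_right, RingHom.id_apply]
    ring

/-- Brackets with a multiple in the first entry: `[f X, Y] = f [X, Y] - (ρ(Y) f) X`. -/
theorem smul_lie_eq (f : R) (X Y : L) : ⁅f • X, Y⁆ = f • ⁅X, Y⁆ - ⁅Y, f⁆ • X := by
  rw [← lie_skew, LieRinehartRing.leibniz_smul_right, ← lie_skew X Y, smul_neg]
  abel

/-- The differential of a `1`-form, `dα(X, Y) = ρ(X)(α(Y)) - ρ(Y)(α(X)) - α([X, Y])`. -/
def dOne (α : Dual R L) : TwoForm R L where
  flat := LinearMap.mk₂ R (fun X Y => ⁅X, α Y⁆ - ⁅Y, α X⁆ - α ⁅X, Y⁆)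
    (fun X X' Y => by simp only [map_add, lie_add, add_lie]; abel)
    (fun f X Y => by
      simp only [map_smul, map_sub, smul_eq_mul, smul_lie_eq, LieRinehartRing.lie_smul_eq_mul,
        LieRinehartRing.leibniz_mul_right]
      ring)
    (fun X Y Y' => by simp only [map_add, lie_add, add_lie]; abel)
    (fun f X Y => by
      simp only [map_smul, map_add, smul_eq_mul, LieRinehartRing.leibniz_smul_right,
        LieRinehartRing.lie_smul_eq_mul, LieRinehartRing.leibniz_mul_right]
      ring)
  alt X := by simp

/-- The differential of a `2`-form:
`dΩ(X, Y, Z) = ρ(X)(Ω(Y, Z)) - ρ(Y)(Ω(X, Z)) + ρ(Z)(Ω(X, Y))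
  - Ω([X, Y], Z) + Ω([X, Z], Y) - Ω([Y, Z], X)`. -/
def dTwo (Ω : TwoForm R L) : ThreeForm R L where
  toMap := LinearMap.mk₂ R
    (fun X Y =>
      { toFun := fun Z => ⁅X, Ω.flat Y Z⁆ - ⁅Y, Ω.flat X Z⁆ + ⁅Z, Ω.flat X Y⁆
          - Ω.flat ⁅X, Y⁆ Z + Ω.flat ⁅X, Z⁆ Y - Ω.flat ⁅Y, Z⁆ X
        map_add' := fun Z Z' => by
          simp only [map_add, lie_add, add_lie, LinearMap.add_apply]; abel
        map_smul' := fun f Z => by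
          simp only [map_smul, map_add, smul_eq_mul, LieRinehartRing.leibniz_smul_right,
            LieRinehartRing.lie_smul_eq_mul, LieRinehartRing.leibniz_mul_right,
            LinearMap.add_apply, LinearMap.smul_apply, RingHom.id_apply]
          rw [Ω.swap Z Y, Ω.swap Z X]
          ring })
    (fun X X' Y => by
      ext Z
      simp only [LinearMap.coe_mk, AddHom.coe_mk, map_add, lie_add, add_lie, LinearMap.add_apply]
      abel)
    (fun f X Y => by
      ext Z
      simp only [LinearMap.coe_mk, AddHom.coe_mk, map_smul, map_sub, smul_eq_mul, smul_lie_eq,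
        LieRinehartRing.lie_smul_eq_mul, LieRinehartRing.leibniz_mul_right,
        LinearMap.sub_apply, LinearMap.smul_apply]
      ring)
    (fun X Y Y' => by
      ext Z
      simp only [LinearMap.coe_mk, AddHom.coe_mk, map_add, lie_add, add_lie, LinearMap.add_apply]
      abel)
    (fun f X Y => by
      ext Z
      simp only [LinearMap.coe_mk, AddHom.coe_mk, map_smul, map_sub, map_add, smul_eq_mul,
        smul_lie_eq, LieRinehartRing.leibniz_smul_right, LieRinehartRing.lie_smul_eq_mul,
        LieRinehartRing.leibniz_mul_right, LinearMap.sub_apply, LinearMap.add_apply,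
        LinearMap.smul_apply]
      rw [Ω.swap Y X]
      ring)
  alt₁₂ X Y := by simp [Ω.alt]
  alt₂₃ X Y := by
    simp only [LinearMap.mk₂_apply, LinearMap.coe_mk, AddHom.coe_mk, Ω.alt, lie_zero, lie_self,
      map_zero, LinearMap.zero_apply]
    ring

/-- The differential of a `3`-form, evaluated on four sections. -/
def dThree (H : ThreeForm R L) (X Y Z W : L) : R :=
  ⁅X, H.toMap Y Z W⁆ - ⁅Y, H.toMap X Z W⁆ + ⁅Z, H.toMap X Y W⁆ - ⁅W, H.toMap X Y Z⁆
    - H.toMap ⁅X, Y⁆ Z W + H.toMap ⁅X, Z⁆ Y W - H.toMap ⁅X, W⁆ Y Z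
    - H.toMap ⁅Y, Z⁆ X W + H.toMap ⁅Y, W⁆ X Z - H.toMap ⁅Z, W⁆ X Y

/-- `dH = 0`; equivalently, `μ + H` is a Courant algebroid structure on `A ⊕ A*`. -/
def ThreeForm.IsClosed (H : ThreeForm R L) : Prop :=
  ∀ X Y Z W : L, dThree H X Y Z W = 0

/-- The Schouten–Nijenhuis bracket of two bivectors, evaluated on three `1`-forms. It is
biadditive, and on decomposable bivectors it is
`[X ∧ Y, Z ∧ W] = [X, Z] ∧ Y ∧ W - [X, W] ∧ Y ∧ Z - [Y, Z] ∧ X ∧ W + [Y, W] ∧ X ∧ Z`. -/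
def schouten (P Q : Bivector R L) (α β γ : Dual R L) : R :=
  lieDer (P.sharp α) β (Q.sharp γ) + lieDer (Q.sharp α) β (P.sharp γ)
    + lieDer (P.sharp β) γ (Q.sharp α) + lieDer (Q.sharp β) γ (P.sharp α)
    + lieDer (P.sharp γ) α (Q.sharp β) + lieDer (Q.sharp γ) α (P.sharp β)

/-- `π` is a Poisson bivector: `[π, π] = 0` for the Schouten–Nijenhuis bracket. -/
def Bivector.IsPoisson (P : Bivector R L) : Prop :=
  ∀ α β γ : Dual R L, schouten P P α β γ = 0

/-- The Dorfman bracket on `Γ(A ⊕ A*)` of the structure `μ + H`, i.e. the derived bracket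
`{{·, μ + H}, ·}`:
`[X + α, Y + β] = [X, Y] + ℒ_X β - i_Y dα - H(X, Y, ·)`.
The sign of the last term is that of `{{X, H}, Y} = -i_Y i_X H`, in the convention for the big
bracket in which `d = {μ, ·}` and `{X, α} = {α, X} = α(X)`. -/
def dorfman (H : ThreeForm R L) (u v : L × Dual R L) : L × Dual R L :=
  (⁅u.1, v.1⁆, lieDer u.1 v.2 - (dOne u.2).flat v.1 - H.toMap u.1 v.1)

/-- The deformed bracket `[u, v]_J = [J u, v] + [u, J v] - J [u, v]`. -/
def deformed (H : ThreeForm R L) (J : (L × Dual R L) →ₗ[R] (L × Dual R L))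
    (u v : L × Dual R L) : L × Dual R L :=
  dorfman H (J u) v + dorfman H u (J v) - J (dorfman H u v)

/-- The Nijenhuis torsion `T_J(u, v) = [J u, J v] - J [u, v]_J`. -/
def torsion (H : ThreeForm R L) (J : (L × Dual R L) →ₗ[R] (L × Dual R L))
    (u v : L × Dual R L) : L × Dual R L :=
  dorfman H (J u) (J v) - J (deformed H J u v)

/-- `J` is an (integrable) c.p.s. structure on `(A ⊕ A*, μ + H)`: an almost c.p.s. structure with
vanishing Nijenhuis torsion. -/
structure IsCPS (H : ThreeForm R L) (lam : ℤ) (J : (L × Dual R L) →ₗ[R] (L × Dual R L)) :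
    Prop extends IsAlmostCPS lam J where
  integrable : ∀ u v, torsion H J u v = 0

/-- A subtangent structure is a c.p.s. structure with `lam = 0`. -/
def IsSubtangent (H : ThreeForm R L) (J : (L × Dual R L) →ₗ[R] (L × Dual R L)) : Prop :=
  IsCPS H 0 J

end LieRinehart

end

/-!
The gauge transformation `e^Ω : X + α ↦ X + (α + Ω♭ X)` preserves the pairing and, by Cartan's
formula for `i_Y i_X dΩ`, carries the Dorfman bracket of `μ - dΩ` to that of `μ`. It also conjugates
`J` to the endomorphism `X + α ↦ π♯ α`, so `J` is a subtangent structure for `μ - dΩ` as soon as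
that endomorphism is one for `μ`. The latter is orthogonal and squares to zero because `π` is a
bivector, and its torsion is the failure of `π♯` to intertwine the Koszul bracket of `1`-forms with
the bracket of sections. Paired with a third `1`-form, twice this failure is `[π, π]`.
-/

namespace LieRinehart

open Module (Dual)

section Forms

variable {R L : Type*} [CommRing R] [AddCommGroup L] [Module R L]

theorem Bivector.swap (P : Bivector R L) (α β : Dual R L) :
    α (P.sharp β) = -β (P.sharp α) := by
  have h := P.alt (α + β)
  simp only [map_add, LinearMap.add_apply, P.alt, zero_add, add_zero] at h
  exact eq_neg_of_add_eq_zero_right h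

@[simp]
theorem TwoForm.neg_flat (Ω : TwoForm R L) : (-Ω).flat = -Ω.flat := rfl

instance : Zero (ThreeForm R L) := ⟨⟨0, fun _ _ => rfl, fun _ _ => rfl⟩⟩

@[simp]
theorem ThreeForm.zero_toMap : (0 : ThreeForm R L).toMap = 0 := rfl

theorem ThreeForm.neg_toMap_apply (H : ThreeForm R L) (X Y Z : L) :
    (-H).toMap X Y Z = -H.toMap X Y Z := rfl

/-- The gauge transformation (or `B`-field transformation) `e^Ω : X + α ↦ X + (α + Ω♭ X)` of
`Γ(A ⊕ A*)`, which relates the Dorfman brackets of `3`-forms differing by `dΩ`. -/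
def gauge (Ω : TwoForm R L) : (L × Dual R L) ≃ₗ[R] (L × Dual R L) where
  toFun u := (u.1, u.2 + Ω.flat u.1)
  invFun u := (u.1, u.2 - Ω.flat u.1)
  map_add' u v := by ext <;> simp; abel
  map_smul' f u := by ext <;> simp
  left_inv u := by simp
  right_inv u := by simp

@[simp]
theorem gauge_apply (Ω : TwoForm R L) (u : L × Dual R L) :
    gauge Ω u = (u.1, u.2 + Ω.flat u.1) := rfl

@[simp]
theorem gauge_symm_apply (Ω : TwoForm R L) (u : L × Dual R L) :
    (gauge Ω).symm u = (u.1, u.2 - Ω.flat u.1) := rfl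

theorem pairing_gauge (Ω : TwoForm R L) (u v : L × Dual R L) :
    pairing (gauge Ω u) (gauge Ω v) = pairing u v := by
  simp only [pairing, gauge_apply, LinearMap.add_apply]
  linear_combination Ω.swap v.1 u.1

/-- The endomorphism `X + α ↦ π♯ α` of `Γ(A ⊕ A*)` given by a bivector, that is, the block matrix
`[[0, π♯], [0, 0]]`. -/
def Bivector.endo (P : Bivector R L) : (L × Dual R L) →ₗ[R] (L × Dual R L) :=
  LinearMap.inl R L (Dual R L) ∘ₗ P.sharp ∘ₗ LinearMap.snd R L (Dual R L)

@[simp]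
theorem Bivector.endo_apply (P : Bivector R L) (u : L × Dual R L) :
    P.endo u = (P.sharp u.2, 0) := rfl

theorem Bivector.isAlmostCPS_endo (P : Bivector R L) : IsAlmostCPS 0 P.endo where
  lam_mem := Or.inr (Or.inl rfl)
  orthogonal u v := by simp [pairing, P.swap u.2 v.2]
  sq u := by simp

theorem blockJ_eq_conj_gauge (P : Bivector R L) (Ω : TwoForm R L) :
    blockJ (nTensor P Ω) P (-omegaN P Ω) = (gauge Ω).symm.conj P.endo := by
  refine LinearMap.ext fun u => Prod.ext ?_ (LinearMap.ext fun Y => ?_)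
  · simp [blockJ, nTensor, add_comm]
  · have dual_comp_nTensor : u.2 (P.sharp (Ω.flat Y)) = Ω.flat (P.sharp u.2) Y := by
      rw [P.swap, Ω.swap, neg_neg]
    simp [blockJ, nTensor, omegaN, dual_comp_nTensor, sub_eq_add_neg, add_comm]

theorem IsAlmostCPS.conj {lam : ℤ} {J : (L × Dual R L) →ₗ[R] (L × Dual R L)}
    (hJ : IsAlmostCPS lam J) (φ : (L × Dual R L) ≃ₗ[R] (L × Dual R L))
    (hφ : ∀ u v, pairing (φ u) (φ v) = pairing u v) : IsAlmostCPS lam (φ.symm.conj J) where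
  lam_mem := hJ.lam_mem
  orthogonal u v := by
    rw [← hφ, ← hφ u]
    simpa using hJ.orthogonal (φ u) (φ v)
  sq u := by simp [hJ.sq]

end Forms

variable {R L : Type*} [CommRing R] [LieRing L] [Module R L] [LieRingModule L R]

theorem ThreeForm.IsClosed.neg {H : ThreeForm R L} (hH : H.IsClosed) : (-H).IsClosed := by
  intro X Y Z W
  have h := hH X Y Z W
  simp only [dThree, ThreeForm.neg_toMap_apply, lie_neg] at h ⊢
  linear_combination -h

variable [LieRinehartRing R L]

theorem lieDer_apply (X : L) (β : Dual R L) (Y : L) :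
    lieDer X β Y = ⁅X, β Y⁆ - β ⁅X, Y⁆ := rfl

theorem lieDer_add (X : L) (α β : Dual R L) :
    lieDer X (α + β) = lieDer X α + lieDer X β := by
  ext Y
  simp only [lieDer_apply, LinearMap.add_apply, lie_add]
  abel

@[simp]
theorem lieDer_zero (X : L) : lieDer X (0 : Dual R L) = 0 := by
  ext Y
  simp [lieDer_apply]

theorem dOne_flat_apply (α : Dual R L) (X Y : L) :
    (dOne α).flat X Y = ⁅X, α Y⁆ - ⁅Y, α X⁆ - α ⁅X, Y⁆ := rfl

theorem dOne_add_flat (α β : Dual R L) :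
    (dOne (α + β)).flat = (dOne α).flat + (dOne β).flat := by
  ext X Y
  simp only [dOne_flat_apply, LinearMap.add_apply, lie_add]
  abel

@[simp]
theorem dOne_zero_flat : (dOne (0 : Dual R L)).flat = 0 := by
  ext X Y
  simp [dOne_flat_apply]

theorem dTwo_toMap_apply (Ω : TwoForm R L) (X Y Z : L) :
    (dTwo Ω).toMap X Y Z = ⁅X, Ω.flat Y Z⁆ - ⁅Y, Ω.flat X Z⁆ + ⁅Z, Ω.flat X Y⁆
      - Ω.flat ⁅X, Y⁆ Z + Ω.flat ⁅X, Z⁆ Y - Ω.flat ⁅Y, Z⁆ X := rfl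

theorem dTwo_isClosed (Ω : TwoForm R L) : (dTwo Ω).IsClosed := by
  intro X Y Z W
  have jacobi (X Y Z W : L) :
      Ω.flat ⁅⁅X, Y⁆, Z⁆ W - Ω.flat ⁅⁅X, Z⁆, Y⁆ W + Ω.flat ⁅⁅Y, Z⁆, X⁆ W = 0 := by
    have h : ⁅⁅X, Y⁆, Z⁆ - ⁅⁅X, Z⁆, Y⁆ + ⁅⁅Y, Z⁆, X⁆ = 0 := by
      rw [lie_lie X Y Z, ← lie_skew ⁅X, Z⁆ Y, ← lie_skew ⁅Y, Z⁆ X]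
      abel
    simpa only [map_add, map_sub, map_zero, LinearMap.add_apply, LinearMap.sub_apply,
      LinearMap.zero_apply] using congrArg (Ω.flat · W) h
  have anchor_lie (X Y : L) (f : R) : ⁅⁅X, Y⁆, f⁆ = ⁅X, ⁅Y, f⁆⁆ - ⁅Y, ⁅X, f⁆⁆ := lie_lie X Y f
  simp only [dThree, dTwo_toMap_apply, lie_add, lie_sub, anchor_lie]
  linear_combination jacobi X Y Z W - jacobi X Y W Z + jacobi X Z W Y - jacobi Y Z W X
    + Ω.swap ⁅X, Y⁆ ⁅Z, W⁆ - Ω.swap ⁅X, Z⁆ ⁅Y, W⁆ + Ω.swap ⁅Y, Z⁆ ⁅X, W⁆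

/-- Cartan's formula for `i_Y i_X dΩ`, solved for `ℒ_X (i_Y Ω)`. -/
theorem lieDer_flat (Ω : TwoForm R L) (X Y : L) :
    lieDer X (Ω.flat Y) =
      Ω.flat ⁅X, Y⁆ + (dOne (Ω.flat X)).flat Y + (dTwo Ω).toMap X Y := by
  ext Z
  simp only [LinearMap.add_apply, lieDer_apply, dOne_flat_apply, dTwo_toMap_apply]
  linear_combination Ω.swap ⁅Y, Z⁆ X - Ω.swap ⁅X, Z⁆ Y

theorem gauge_dorfman {H H' : ThreeForm R L} {Ω : TwoForm R L}
    (hH : H'.toMap = H.toMap + (dTwo Ω).toMap) (u v : L × Dual R L) :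
    gauge Ω (dorfman H u v) = dorfman H' (gauge Ω u) (gauge Ω v) := by
  refine Prod.ext rfl ?_
  simp only [dorfman, gauge_apply, lieDer_add, lieDer_flat, dOne_add_flat, hH, LinearMap.add_apply]
  abel

theorem torsion_conj {H H' : ThreeForm R L} (φ : (L × Dual R L) ≃ₗ[R] (L × Dual R L))
    (hφ : ∀ u v, φ (dorfman H u v) = dorfman H' (φ u) (φ v))
    (J : (L × Dual R L) →ₗ[R] (L × Dual R L)) (u v : L × Dual R L) :
    torsion H (φ.symm.conj J) u v = φ.symm (torsion H' J (φ u) (φ v)) := by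
  rw [LinearEquiv.eq_symm_apply]
  simp [torsion, deformed, hφ]

theorem IsCPS.conj {H H' : ThreeForm R L} {lam : ℤ} {J : (L × Dual R L) →ₗ[R] (L × Dual R L)}
    (hJ : IsCPS H' lam J) (φ : (L × Dual R L) ≃ₗ[R] (L × Dual R L))
    (hpair : ∀ u v, pairing (φ u) (φ v) = pairing u v)
    (hdorf : ∀ u v, φ (dorfman H u v) = dorfman H' (φ u) (φ v)) :
    IsCPS H lam (φ.symm.conj J) where
  toIsAlmostCPS := hJ.toIsAlmostCPS.conj φ hpair
  integrable u v := by rw [torsion_conj φ hdorf, hJ.integrable, map_zero]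

/-- The Koszul bracket `[α, β]_π = ℒ_{π♯ α} β - i_{π♯ β} dα` of `1`-forms. -/
def Bivector.koszul (P : Bivector R L) (α β : Dual R L) : Dual R L :=
  lieDer (P.sharp α) β - (dOne α).flat (P.sharp β)

theorem schouten_self (P : Bivector R L) (α β γ : Dual R L) :
    schouten P P α β γ = 2 * γ (⁅P.sharp α, P.sharp β⁆ - P.sharp (P.koszul α β)) := by
  have swap_lie (X Y : L) (δ : Dual R L) : δ ⁅X, Y⁆ = -δ ⁅Y, X⁆ := by
    rw [← map_neg, lie_skew]
  rw [map_sub, P.swap γ]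
  simp only [schouten, Bivector.koszul, LinearMap.sub_apply, lieDer_apply, dOne_flat_apply,
    P.swap γ α, lie_neg]
  linear_combination -2 * swap_lie (P.sharp α) (P.sharp β) γ
    - 2 * swap_lie (P.sharp β) (P.sharp γ) α

theorem Bivector.torsion_endo (P : Bivector R L) (u v : L × Dual R L) :
    torsion 0 P.endo u v = (⁅P.sharp u.2, P.sharp v.2⁆ - P.sharp (P.koszul u.2 v.2), 0) := by
  refine Prod.ext ?_ ?_ <;> simp [torsion, deformed, dorfman, koszul, sub_eq_add_neg]

theorem Bivector.IsPoisson.lie_sharp (h2 : (2 : R) ∈ nonZeroDivisors R)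
    (hsep : Function.Injective (Dual.eval R L)) {P : Bivector R L} (hP : P.IsPoisson)
    (α β : Dual R L) : ⁅P.sharp α, P.sharp β⁆ = P.sharp (P.koszul α β) := by
  refine sub_eq_zero.1 ((map_eq_zero_iff _ hsep).1 (LinearMap.ext fun γ => ?_))
  have defect : 2 * γ (⁅P.sharp α, P.sharp β⁆ - P.sharp (P.koszul α β)) = 0 := by
    rw [← schouten_self, hP]
  exact (mul_left_mem_nonZeroDivisors_eq_zero_iff h2).1 defect

theorem Bivector.IsPoisson.isSubtangent_endo (h2 : (2 : R) ∈ nonZeroDivisors R)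
    (hsep : Function.Injective (Dual.eval R L)) {P : Bivector R L} (hP : P.IsPoisson) :
    IsSubtangent 0 P.endo where
  toIsAlmostCPS := P.isAlmostCPS_endo
  integrable u v := by rw [P.torsion_endo, hP.lie_sharp h2 hsep, sub_self, Prod.mk_zero_zero]

end LieRinehart

section Separation

open Bundle

theorem contMDiff_smul_clm_linearMapAt {𝕜 : Type*} [NontriviallyNormedField 𝕜]
    {E H M : Type*} [NormedAddCommGroup E] [NormedSpace 𝕜 E] [TopologicalSpace H]
    {I : ModelWithCorners 𝕜 E H} [TopologicalSpace M] [ChartedSpace H M]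
    {F G : Type*} [NormedAddCommGroup F] [NormedSpace 𝕜 F] [NormedAddCommGroup G] [NormedSpace 𝕜 G]
    {V : M → Type*} [TopologicalSpace (TotalSpace F V)] [∀ x, TopologicalSpace (V x)]
    [∀ x, AddCommGroup (V x)] [∀ x, Module 𝕜 (V x)] [FiberBundle F V] [VectorBundle 𝕜 F V]
    {n : ℕ∞ω} [ContMDiffVectorBundle n F V I]
    (e : Trivialization F (π F V)) [MemTrivializationAtlas e]
    {χ : M → 𝕜} (hχ : ContMDiff I 𝓘(𝕜, 𝕜) n χ) (hsupp : tsupport χ ⊆ e.baseSet)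
    (ℓ : F →L[𝕜] G) {s : ∀ x, V x}
    (hs : ContMDiff I (I.prod 𝓘(𝕜, F)) n fun x => TotalSpace.mk' F x (s x)) :
    ContMDiff I 𝓘(𝕜, G) n fun x => χ x • ℓ (e.linearMapAt 𝕜 x (s x)) := by
  refine contMDiff_of_tsupport fun x hx => ?_
  have hxe : x ∈ e.baseSet := hsupp (tsupport_smul_subset_left _ _ hx)
  have hes : ContMDiffAt I 𝓘(𝕜, F) n (fun y => e.linearMapAt 𝕜 y (s y)) x := by
    refine ((e.contMDiffAt_section_iff hxe).1 (hs x)).congr_of_eventuallyEq ?_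
    filter_upwards [e.open_baseSet.mem_nhds hxe] with y hy
    rw [e.coe_linearMapAt_of_mem hy]
  exact (hχ x).smul (ℓ.contMDiff.contMDiffAt.comp x hes)

namespace LieAlgebroid

variable {E : Type*} [NormedAddCommGroup E] [NormedSpace ℝ E]
  {M : Type*} [TopologicalSpace M] [ChartedSpace E M] [IsManifold 𝓘(ℝ, E) ∞ M]
  {F : Type*} [NormedAddCommGroup F] [NormedSpace ℝ F]
  {V : M → Type*} [TopologicalSpace (TotalSpace F V)]
  [∀ x, TopologicalSpace (V x)] [∀ x, AddCommGroup (V x)] [∀ x, Module ℝ (V x)]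
  [FiberBundle F V] [VectorBundle ℝ F V] [ContMDiffVectorBundle ∞ F V 𝓘(ℝ, E)]

/-- The `1`-form `Y ↦ χ · ℓ(Y)` that equals the constant covector `ℓ` in the local trivialization
`e`, cut off by a function `χ` supported where `e` is defined. -/
noncomputable def cutoffForm (A : LieAlgebroid E F V) (e : Trivialization F (π F V))
    [MemTrivializationAtlas e] (χ : C^∞⟮𝓘(ℝ, E), M; ℝ⟯) (hsupp : tsupport χ ⊆ e.baseSet)
    (ℓ : F →L[ℝ] ℝ) : Module.Dual C^∞⟮𝓘(ℝ, E), M; ℝ⟯ A.Sec where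
  toFun Y := ⟨fun x => χ x • ℓ (e.linearMapAt ℝ x (Y.toFun x)),
    contMDiff_smul_clm_linearMapAt e χ.contMDiff hsupp ℓ Y.contMDiff_toFun⟩
  map_add' Y Z := by
    ext x
    change χ x • ℓ (e.linearMapAt ℝ x (Y.toFun x + Z.toFun x)) =
      χ x • ℓ (e.linearMapAt ℝ x (Y.toFun x)) + χ x • ℓ (e.linearMapAt ℝ x (Z.toFun x))
    rw [map_add, map_add, smul_add]
  map_smul' f Y := by
    ext x
    change χ x • ℓ (e.linearMapAt ℝ x (f x • Y.toFun x)) =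
      f x • χ x • ℓ (e.linearMapAt ℝ x (Y.toFun x))
    rw [map_smul, map_smul, smul_comm]

theorem injective_dual_eval [FiniteDimensional ℝ E] [T2Space M] (A : LieAlgebroid E F V) :
    Function.Injective (Module.Dual.eval C^∞⟮𝓘(ℝ, E), M; ℝ⟯ A.Sec) := by
  refine (injective_iff_map_eq_zero _).2 fun X hX => ContMDiffSection.ext fun x => ?_
  let e := trivializationAt F V x
  have hx : x ∈ e.baseSet := FiberBundle.mem_baseSet_trivializationAt' x
  obtain ⟨χ, hχ, -⟩ := (SmoothBumpFunction.nhds_basis_support (I := 𝓘(ℝ, E))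
    (e.open_baseSet.mem_nhds hx)).mem_iff.1 (e.open_baseSet.mem_nhds hx)
  have covector_apply (ℓ : F →L[ℝ] ℝ) : ℓ (e.linearMapAt ℝ x (X.toFun x)) = 0 := by
    have h : A.cutoffForm e ⟨χ, χ.contMDiff⟩ hχ ℓ X = 0 :=
      LinearMap.congr_fun hX (A.cutoffForm e ⟨χ, χ.contMDiff⟩ hχ ℓ)
    have cutoff_apply : χ x * ℓ (e.linearMapAt ℝ x (X.toFun x)) = 0 := DFunLike.congr_fun h x
    rwa [χ.eq_one, one_mul] at cutoff_apply
  have linearMapAt_eq_zero : e.linearMapAt ℝ x (X.toFun x) = 0 :=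
    SeparatingDual.eq_zero_of_forall_dual_eq_zero (R := ℝ) covector_apply
  change X.toFun x = 0
  rw [← e.symmₗ_linearMapAt (R := ℝ) hx (X.toFun x), linearMapAt_eq_zero, map_zero]

end LieAlgebroid

end Separation

theorem two_mem_nonZeroDivisors_of_algebra (𝕜 R : Type*) [Field 𝕜] [NeZero (2 : 𝕜)] [CommRing R]
    [Algebra 𝕜 R] : (2 : R) ∈ nonZeroDivisors R := by
  rw [← map_ofNat (algebraMap 𝕜 R) 2]
  exact ((IsUnit.mk0 (2 : 𝕜) two_ne_zero).map _).mem_nonZeroDivisors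

open LieRinehart in
theorem mainTheorem7_general {R L : Type*} [CommRing R] [LieRing L] [Module R L]
    [LieRingModule L R] [LieRinehartRing R L] (h2 : (2 : R) ∈ nonZeroDivisors R)
    (hsep : Function.Injective (Module.Dual.eval R L))
    (P : Bivector R L) (hP : P.IsPoisson) (Ω : TwoForm R L) :
    (-dTwo Ω).IsClosed ∧
      IsSubtangent (-dTwo Ω) (blockJ (nTensor P Ω) P (-omegaN P Ω)) := by
  refine ⟨(dTwo_isClosed Ω).neg, ?_⟩
  rw [blockJ_eq_conj_gauge]
  have gauge_isometry := pairing_gauge Ω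
  have gauge_bracket : ∀ u v, gauge Ω (dorfman (-dTwo Ω) u v) =
      dorfman 0 (gauge Ω u) (gauge Ω v) :=
    gauge_dorfman (by ext; simp [ThreeForm.neg_toMap_apply])
  exact IsCPS.conj (hP.isSubtangent_endo h2 hsep) (gauge Ω) gauge_isometry gauge_bracket

theorem mainTheorem7
    {E : Type*} [NormedAddCommGroup E] [NormedSpace ℝ E] [FiniteDimensional ℝ E]
    {M : Type*} [TopologicalSpace M] [T2Space M] [SecondCountableTopology M]
    [ChartedSpace E M] [IsManifold 𝓘(ℝ, E) ∞ M]
    {F : Type*} [NormedAddCommGroup F] [NormedSpace ℝ F] [FiniteDimensional ℝ F]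
    {V : M → Type*} [TopologicalSpace (Bundle.TotalSpace F V)]
    [∀ x, TopologicalSpace (V x)] [∀ x, AddCommGroup (V x)] [∀ x, Module ℝ (V x)]
    [FiberBundle F V] [VectorBundle ℝ F V] [ContMDiffVectorBundle ∞ F V 𝓘(ℝ, E)]
    (A : LieAlgebroid E F V)
    (P : LieRinehart.Bivector C^∞⟮𝓘(ℝ, E), M; ℝ⟯ A.Sec) (hP : P.IsPoisson)
    (Ω : LieRinehart.TwoForm C^∞⟮𝓘(ℝ, E), M; ℝ⟯ A.Sec) :
    (-LieRinehart.dTwo Ω).IsClosed ∧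
      LieRinehart.IsSubtangent (-LieRinehart.dTwo Ω)
        (LieRinehart.blockJ (LieRinehart.nTensor P Ω) P (-LieRinehart.omegaN P Ω)) := by
  exact mainTheorem7_general (two_mem_nonZeroDivisors_of_algebra ℝ _) A.injective_dual_eval P hP Ω
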